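/- Let $n\ge 1$ and $k,m\ge 0$ be integers. The conditional restricted Boltzmann machine $\mathrm{RBM}^k_{n,m}$ with $k$ binary input, $n$ binary output and $m$ binary hidden units is the set of all conditional distributions of the form $$p(y|x)=\frac{\sum_{z\in\{0,1\}^m}\exp\left(z^\top Vx+z^\top Wy+b^\top y+c^\top z\right)}{\sum_{y'\in\{0,1\}^n}\sum_{z\in\{0,1\}^m}\exp\left(z^\top Vx+z^\top Wy'+b^\top y'+c^\top z\right)},\qquad x\in\{0,1\}^k,\ y\in\{0,1\}^n,$$ with $V\in\mathbb{R}^{m\times k}$, $W\in\mathbb{R}^{m\times n}$, $b\in\mathbb{R}^n$, $c\in\mathbb{R}^m$. A conditional distribution $p(\cdot|\cdot)$ of $y\in\{0,1\}^n$ given $x\in\{0,1\}^k$ is called deterministic if for each $x$ exactly one $y$ has $p(y|x)>0$, that is, if $p(y|x)=\delta_{f(x)}(y)$ for some function $f\colon\{0,1\}^k\to\{0,1\}^n$. A model can approximate $p$ arbitrarily well if for every $\varepsilon>0$ it contains some $q$ with $|q(y|x)-p(y|x)|<\varepsilon$ for all $x,y$. (i) If $m\ge\min\left\{2^k-1,\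 \frac{3n}{k+2}\,2^k\right\}$, then $\mathrm{RBM}^k_{n,m}$ can approximate every deterministic conditional distribution arbitrarily well. (ii) Conversely, suppose $(k,n)\neq(0,1)$. If $\mathrm{RBM}^k_{n,m}$ can approximate every deterministic conditional distribution arbitrarily well, then $m\ge 2^{k/2}-\frac{(n+k)^2}{2n}$. -/

import Mathlib

open scoped Matrix

noncomputable section

/-- The states of `n` binary units, `{0,1}^n`. -/
abbrev BinState (n : ℕ) : Type := Fin n → Bool

/-- A binary state regarded as a column vector with real entries `0` and `1`. -/
def BinState.vec {n : ℕ} (x : BinState n) : Fin n → ℝ := fun i => if x i then 1 else 0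

/-- Real `2^k × 2^n` matrices `p`, with `p x y` standing for `p(y|x)`. -/
abbrev CondArray (k n : ℕ) : Type := BinState k → BinState n → ℝ

/-- The polytope `Δ_{k,n}` of conditional distributions of `y ∈ {0,1}^n` given `x ∈ {0,1}^k`:
the row-stochastic matrices. -/
def condDistributions (k n : ℕ) : Set (CondArray k n) :=
  {p | (∀ x y, 0 ≤ p x y) ∧ ∀ x, ∑ y, p x y = 1}

/-- The deterministic conditional distributions: for each input, exactly one output has positive
probability. -/
def deterministicPolicies (k n : ℕ) : Set (CondArray k n) :=
  {p | p ∈ condDistributions k n ∧ ∀ x, ∃! y, 0 < p x y}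

/-- Parameters of a conditional restricted Boltzmann machine with `k` input, `n` output and
`m` hidden units. -/
structure CRBMParams (k n m : ℕ) where
  /-- input-to-hidden interaction weights -/
  V : Matrix (Fin m) (Fin k) ℝ
  /-- output-to-hidden interaction weights -/
  W : Matrix (Fin m) (Fin n) ℝ
  /-- output biases -/
  b : Fin n → ℝ
  /-- hidden biases -/
  c : Fin m → ℝ

namespace CRBMParams

variable {k n m : ℕ}

/-- The exponent `zᵀ V x + zᵀ W y + bᵀ y + cᵀ z`. -/
def exponent (θ : CRBMParams k n m) (x : BinState k) (y : BinState n) (z : BinState m) : ℝ :=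
  z.vec ⬝ᵥ (θ.V *ᵥ x.vec) + z.vec ⬝ᵥ (θ.W *ᵥ y.vec) + θ.b ⬝ᵥ y.vec + θ.c ⬝ᵥ z.vec

/-- The normalization function `Z(W, b, V x + c)`. -/
def partition (θ : CRBMParams k n m) (x : BinState k) : ℝ :=
  ∑ y : BinState n, ∑ z : BinState m, Real.exp (θ.exponent x y z)

/-- The conditional distribution `p(y|x)` represented by the parameters. -/
def cond (θ : CRBMParams k n m) : CondArray k n := fun x y =>
  (∑ z : BinState m, Real.exp (θ.exponent x y z)) / θ.partition x

end CRBMParams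

/-- The model `RBM^k_{n,m}`: all conditional distributions represented by some choice of
parameters. -/
def CRBM (k n m : ℕ) : Set (CondArray k n) := Set.range (CRBMParams.cond (k := k) (n := n) (m := m))

/-- A model `M` can approximate `p` arbitrarily well: entrywise to any precision in the
finite-dimensional space of `2^k × 2^n` matrices. -/
def ApproximatesArbitrarilyWell {k n : ℕ} (M : Set (CondArray k n)) (p : CondArray k n) : Prop :=
  ∀ ε : ℝ, 0 < ε → ∃ q ∈ M, ∀ x y, |q x y - p x y| < ε

end

/-! The sum over the `2 ^ m` hidden states lies within a factor `2 ^ m` of its largest term, the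
exponential of `score`. Scaling all parameters up concentrates each conditional on the maximizers of
the score. Hence the policy of `f` is approximable exactly when `f x` is the strict maximizer of
some score for every `x` (`Realizable.approximates`, `Realizable.of_approximates`).

Sufficiency: with large input weights, whether a hidden unit is active depends on `x` alone. The
score is then affine in `y`, and its maximizer is the output of a two-layer threshold network
(`realizable_of_threshold_network`). One unit per nonzero input gives `2 ^ k - 1`. Alternatively, a
radius-one covering code splits each output bit into stars of the cube, and at most `3 * 2 ^ k / (k
+ 2)` threshold units per bit suffice (`exists_hasThresholdDepthTwo`).

Necessity: for a fixed activation pattern of the hidden units the score is linear in the parameters,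
and the signs of score differences determine `f`. Sauer–Shelah bounds the number of sign patterns
(`card_positivitySets_le`), and all `2 ^ (n * 2 ^ k)` functions must be accounted for
(`two_pow_le_of_realizable`). This beats the claimed bound for `k ≥ 20`; for `k ≤ 8` the claim is
trivial, and the values between reduce to finitely many numerical checks. -/

/-! ### Deterministic limits and maximizers of the score -/

/-- The largest exponent over the hidden states, for the output state `y` given the input
state `x`. The hidden units may be indexed by any finite type. -/
noncomputable def score {k n : ℕ} {ι : Type} [Fintype ι] (V : ι → Fin k → ℝ) (W : ι → Fin n → ℝ)
    (c : ι → ℝ) (b : Fin n → ℝ) (x : BinState k) (y : BinState n) : ℝ :=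
  b ⬝ᵥ y.vec + ∑ j, max 0 (V j ⬝ᵥ x.vec + W j ⬝ᵥ y.vec + c j)

/-- `f` is the strict maximizer of the score for some parameters with hidden units `ι`. -/
def Realizable {k n : ℕ} (ι : Type) [Fintype ι] (f : BinState k → BinState n) : Prop :=
  ∃ (V : ι → Fin k → ℝ) (W : ι → Fin n → ℝ) (c : ι → ℝ) (b : Fin n → ℝ),
    ∀ x y, y ≠ f x → score V W c b x y < score V W c b x (f x)

theorem Realizable.of_embedding {k n : ℕ} {ι κ : Type} [Fintype ι] [Fintype κ]
    {f : BinState k → BinState n} (e : ι ↪ κ) (h : Realizable ι f) : Realizable κ f := by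
  obtain ⟨V, W, c, b, h⟩ := h
  refine ⟨Function.extend e V 0, Function.extend e W 0, Function.extend e c 0, b, ?_⟩
  have key : ∀ x y, score (Function.extend e V 0) (Function.extend e W 0)
      (Function.extend e c 0) b x y = score V W c b x y := by
    intro x y
    unfold score
    congr 1
    symm
    refine Fintype.sum_of_injective e e.injective _ _ ?_ ?_
    · intro j hj
      have hj' : ¬ ∃ a, e a = j := hj
      simp [Function.extend_apply' _ _ _ hj']
    · intro j
      simp [e.injective.extend_apply]
  intro x y hy
  rw [key, key]
  exact h x y hy

theorem BinState.vec_append_zero {n d : ℕ} (y : BinState n) (w : Fin (n + d) → ℝ) :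
    w ⬝ᵥ BinState.vec (Fin.append y (fun _ : Fin d => false)) =
      (fun i => w (Fin.castAdd d i)) ⬝ᵥ y.vec := by
  simp [dotProduct, Fin.sum_univ_add, BinState.vec]

/-- Outputs padded with zeros do not see the extra weights, so a maximizer among all long outputs
also wins among the padded ones. -/
theorem Realizable.restrict_output {k n d : ℕ} {ι : Type} [Fintype ι]
    {f : BinState k → BinState n}
    (h : Realizable ι (fun x => Fin.append (f x) (fun _ : Fin d => false))) :
    Realizable ι f := by
  obtain ⟨V, W, c, b, h⟩ := h
  refine ⟨V, fun j i => W j (Fin.castAdd d i), c, fun i => b (Fin.castAdd d i), ?_⟩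
  intro x y hy
  have h1 := h x (Fin.append y (fun _ : Fin d => false)) (by
    intro h2
    apply hy
    funext i
    have := congrFun h2 (Fin.castAdd d i)
    simpa using this)
  simpa only [score, BinState.vec_append_zero] using h1

namespace CRBMParams

variable {k n m : ℕ}

theorem exponent_eq (θ : CRBMParams k n m) (x : BinState k) (y : BinState n) (z : BinState m) :
    θ.exponent x y z =
      θ.b ⬝ᵥ y.vec + ∑ j, z.vec j * (θ.V j ⬝ᵥ x.vec + θ.W j ⬝ᵥ y.vec + θ.c j) := by
  simp only [exponent, dotProduct, Matrix.mulVec, mul_add, Finset.sum_add_distrib]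
  rw [Finset.sum_congr rfl (fun j _ => mul_comm (θ.c j) (z.vec j))]
  ring

theorem exponent_le_score (θ : CRBMParams k n m) (x : BinState k) (y : BinState n)
    (z : BinState m) : θ.exponent x y z ≤ score θ.V θ.W θ.c θ.b x y := by
  rw [exponent_eq]; unfold score
  gcongr with j
  unfold BinState.vec
  split_ifs <;> simp

theorem exists_exponent_eq_score (θ : CRBMParams k n m) (x : BinState k) (y : BinState n) :
    ∃ z : BinState m, θ.exponent x y z = score θ.V θ.W θ.c θ.b x y := by
  refine ⟨fun j => decide (0 < θ.V j ⬝ᵥ x.vec + θ.W j ⬝ᵥ y.vec + θ.c j), ?_⟩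
  rw [exponent_eq]; unfold score
  congr 1
  refine Finset.sum_congr rfl fun j _ => ?_
  by_cases h : 0 < θ.V j ⬝ᵥ x.vec + θ.W j ⬝ᵥ y.vec + θ.c j
  · simp [BinState.vec, h, max_eq_right h.le]
  · simp [BinState.vec, h, max_eq_left (not_lt.mp h)]

/-- The unnormalized probability of `y` given `x`. -/
noncomputable def weight (θ : CRBMParams k n m) (x : BinState k) (y : BinState n) : ℝ :=
  ∑ z : BinState m, Real.exp (θ.exponent x y z)

theorem exp_score_le_weight (θ : CRBMParams k n m) (x : BinState k) (y : BinState n) :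
    Real.exp (score θ.V θ.W θ.c θ.b x y) ≤ θ.weight x y := by
  obtain ⟨z, hz⟩ := θ.exists_exponent_eq_score x y
  rw [← hz]
  exact Finset.single_le_sum (f := fun z => Real.exp (θ.exponent x y z))
    (fun _ _ => (Real.exp_pos _).le) (Finset.mem_univ z)

theorem weight_le (θ : CRBMParams k n m) (x : BinState k) (y : BinState n) :
    θ.weight x y ≤ 2 ^ m * Real.exp (score θ.V θ.W θ.c θ.b x y) := by
  calc θ.weight x y ≤ ∑ _z : BinState m, Real.exp (score θ.V θ.W θ.c θ.b x y) :=
        Finset.sum_le_sum fun z _ => Real.exp_le_exp.mpr (θ.exponent_le_score x y z)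
    _ = _ := by simp

theorem weight_pos (θ : CRBMParams k n m) (x : BinState k) (y : BinState n) :
    0 < θ.weight x y := (Real.exp_pos _).trans_le (θ.exp_score_le_weight x y)

theorem weight_le_partition (θ : CRBMParams k n m) (x : BinState k) (y : BinState n) :
    θ.weight x y ≤ θ.partition x :=
  Finset.single_le_sum (f := fun y => θ.weight x y)
    (fun y _ => (θ.weight_pos x y).le) (Finset.mem_univ y)

theorem partition_pos (θ : CRBMParams k n m) (x : BinState k) : 0 < θ.partition x :=
  (θ.weight_pos x (fun _ => false)).trans_le (θ.weight_le_partition x _)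

theorem cond_eq (θ : CRBMParams k n m) (x : BinState k) (y : BinState n) :
    θ.cond x y = θ.weight x y / θ.partition x := rfl

theorem cond_nonneg (θ : CRBMParams k n m) (x : BinState k) (y : BinState n) :
    0 ≤ θ.cond x y := div_nonneg (θ.weight_pos x y).le (θ.partition_pos x).le

theorem sum_cond (θ : CRBMParams k n m) (x : BinState k) : ∑ y, θ.cond x y = 1 := by
  simp only [cond_eq]
  rw [← Finset.sum_div]
  exact div_self (θ.partition_pos x).ne'

theorem cond_le (θ : CRBMParams k n m) (x : BinState k) (y y' : BinState n) :
    θ.cond x y ≤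
      2 ^ m * Real.exp (score θ.V θ.W θ.c θ.b x y - score θ.V θ.W θ.c θ.b x y') := by
  rw [cond_eq, Real.exp_sub, ← mul_div_assoc]
  exact div_le_div₀ (by positivity) (θ.weight_le x y) (Real.exp_pos _)
    ((θ.exp_score_le_weight x y').trans (θ.weight_le_partition x y'))

end CRBMParams

/-- The conditional distribution concentrated on the graph of `f`. -/
noncomputable def pointMass {k n : ℕ} (f : BinState k → BinState n) : CondArray k n :=
  fun x y => if y = f x then 1 else 0

theorem pointMass_mem {k n : ℕ} (f : BinState k → BinState n) :
    pointMass f ∈ deterministicPolicies k n := by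
  refine ⟨⟨fun x y => ?_, fun x => ?_⟩, fun x => ⟨f x, ?_, fun y hy => ?_⟩⟩
  · unfold pointMass; split_ifs <;> norm_num
  · simp [pointMass]
  · simp [pointMass]
  · by_contra h
    simp [pointMass, h] at hy

theorem exists_eq_pointMass {k n : ℕ} {p : CondArray k n} (hp : p ∈ deterministicPolicies k n) :
    ∃ f, p = pointMass f := by
  obtain ⟨⟨h0, h1⟩, h2⟩ := hp
  choose f hf hf' using h2
  refine ⟨f, ?_⟩
  have hz : ∀ x y, y ≠ f x → p x y = 0 := fun x y hy =>
    le_antisymm (not_lt.mp fun h => hy (hf' x y h)) (h0 x y)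
  funext x y
  by_cases h : y = f x
  · have := h1 x
    rw [Finset.sum_eq_single (f x) (fun y _ hy => hz x y hy) (by simp)] at this
    simp [pointMass, h, this]
  · simp [pointMass, h, hz x y h]

theorem score_smul {k n : ℕ} {ι : Type} [Fintype ι] (V : ι → Fin k → ℝ) (W : ι → Fin n → ℝ)
    (c : ι → ℝ) (b : Fin n → ℝ) (x : BinState k) (y : BinState n) {t : ℝ} (ht : 0 ≤ t) :
    score (fun j => t • V j) (fun j => t • W j) (fun j => t * c j) (t • b) x y =
      t * score V W c b x y := by
  simp only [score, smul_dotProduct, smul_eq_mul, mul_add, Finset.mul_sum, mul_max_of_nonneg _ _ ht,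
    mul_zero]

theorem Realizable.approximates {k n m : ℕ} {f : BinState k → BinState n}
    (h : Realizable (Fin m) f) : ApproximatesArbitrarilyWell (CRBM k n m) (pointMass f) := by
  obtain ⟨V, W, c, b, h⟩ := h
  intro ε hε
  set S := score V W c b with hS
  let θ : ℝ → CRBMParams k n m := fun t =>
    ⟨fun j => t • V j, fun j => t • W j, t • b, fun j => t * c j⟩
  -- The tolerance `ε / 2 ^ n` leaves total mass below `ε` on the fewer than `2 ^ n` wrong outputs.
  have hlim : ∀ x y, y ≠ f x → ∀ᶠ t : ℝ in Filter.atTop, (θ t).cond x y < ε / 2 ^ n := by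
    intro x y hy
    have h1 : Filter.Tendsto (fun t : ℝ => 2 ^ m * Real.exp (t * (S x y - S x (f x))))
        Filter.atTop (nhds (2 ^ m * 0)) :=
      ((Real.tendsto_exp_atBot).comp
        (Filter.tendsto_id.atTop_mul_const_of_neg (sub_neg.mpr (h x y hy)))).const_mul _
    rw [mul_zero] at h1
    filter_upwards [h1.eventually_lt_const (show (0 : ℝ) < ε / 2 ^ n by positivity),
      Filter.eventually_ge_atTop 0] with t ht ht0
    refine lt_of_le_of_lt ((θ t).cond_le x y (f x)) ?_
    have e : ∀ y, score (θ t).V (θ t).W (θ t).c (θ t).b x y = t * S x y :=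
      fun y => score_smul V W c b x y ht0
    rw [e, e, ← mul_sub]
    exact ht
  have hall : ∀ᶠ t : ℝ in Filter.atTop, ∀ x y, y ≠ f x → (θ t).cond x y < ε / 2 ^ n := by
    rw [Filter.eventually_all]; intro x
    rw [Filter.eventually_all]; intro y
    by_cases hy : y = f x
    · simp [hy]
    · simpa [hy] using hlim x y hy
  obtain ⟨t, ht⟩ := hall.exists
  refine ⟨(θ t).cond, ⟨θ t, rfl⟩, fun x y => ?_⟩
  have hone : (1 : ℝ) ≤ 2 ^ n := one_le_pow₀ (by norm_num)
  by_cases hy : y = f x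
  · have h1 := (θ t).sum_cond x
    rw [← Finset.add_sum_erase _ _ (Finset.mem_univ (f x))] at h1
    have h2 : ∑ y ∈ Finset.univ.erase (f x), (θ t).cond x y ≤
        ∑ _y ∈ Finset.univ.erase (f x), ε / 2 ^ n :=
      Finset.sum_le_sum fun y hy => (ht x y (Finset.ne_of_mem_erase hy)).le
    have h3 : (Finset.univ.erase (f x)).card < 2 ^ n := by
      simp
    have h3' : ((Finset.univ.erase (f x)).card : ℝ) < 2 ^ n := by exact_mod_cast h3
    have h4 : ∑ _y ∈ Finset.univ.erase (f x), ε / 2 ^ n < ε := by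
      rw [Finset.sum_const, nsmul_eq_mul, mul_div_assoc', div_lt_iff₀ (by positivity), mul_comm ε]
      exact mul_lt_mul_of_pos_right h3' hε
    have h5 : 0 ≤ ∑ y ∈ Finset.univ.erase (f x), (θ t).cond x y :=
      Finset.sum_nonneg fun y _ => (θ t).cond_nonneg x y
    subst hy
    simp only [pointMass, if_true, abs_lt]
    constructor <;> linarith
  · simp only [pointMass, hy, if_false, sub_zero, abs_of_nonneg ((θ t).cond_nonneg x y)]
    exact (ht x y hy).trans_le (div_le_self hε.le hone)

theorem Realizable.of_approximates {k n m : ℕ} {f : BinState k → BinState n}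
    (h : ApproximatesArbitrarilyWell (CRBM k n m) (pointMass f)) : Realizable (Fin m) f := by
  have hM : (0 : ℝ) < 2 ^ m := by positivity
  -- With `ε = 1 / (2 ^ m + 1)` one has `1 - ε = 2 ^ m * ε`, so the weight of `f x` exceeds `2 ^ m`
  -- times any other. That is just enough to absorb the factor lost between weight and exponential
  -- score.
  obtain ⟨q, ⟨θ, rfl⟩, hq⟩ := h (1 / (2 ^ m + 1)) (by positivity)
  refine ⟨θ.V, θ.W, θ.c, θ.b, fun x y hy => ?_⟩
  have h1 := (abs_lt.mp (hq x (f x))).1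
  have h2 := (abs_lt.mp (hq x y)).2
  simp only [pointMass, hy, if_true, if_false, sub_zero, CRBMParams.cond_eq] at h1 h2
  have hZ := θ.partition_pos x
  have h3 : 2 ^ m * (θ.weight x y / θ.partition x) < θ.weight x (f x) / θ.partition x := by
    have : (2 : ℝ) ^ m * (1 / (2 ^ m + 1)) = 1 - 1 / (2 ^ m + 1) := by field_simp; ring
    nlinarith
  rw [← mul_div_assoc, div_lt_div_iff_of_pos_right hZ] at h3
  have h4 := h3.trans_le (θ.weight_le x (f x))
  have h5 := (θ.exp_score_le_weight x y).trans_lt (lt_of_mul_lt_mul_left h4 hM.le)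
  exact Real.exp_lt_exp.mp h5

/-! ### Threshold networks as hidden layers -/

/-- A Boolean function that is the strict positivity of an affine function vanishing nowhere on
the cube. -/
def IsLinearThreshold {k : ℕ} (g : BinState k → Bool) : Prop :=
  ∃ (v : Fin k → ℝ) (c : ℝ), ∀ x, v ⬝ᵥ x.vec + c ≠ 0 ∧ (g x = true ↔ 0 < v ⬝ᵥ x.vec + c)

/-- The sign `±1` of a truth value. -/
def boolSign (a : Bool) : ℝ := if a then 1 else -1

theorem score_lt_of_sign {n : ℕ} (a : Fin n → ℝ) (y y' : BinState n)
    (h : ∀ i, 0 < boolSign (y' i) * a i) (hy : y ≠ y') : a ⬝ᵥ y.vec < a ⬝ᵥ y'.vec := by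
  have hle : ∀ i, a i * y.vec i ≤ a i * y'.vec i ∧
      (y i ≠ y' i → a i * y.vec i < a i * y'.vec i) := by
    intro i
    have := h i
    cases h1 : y i <;> cases h2 : y' i <;> simp_all [boolSign, BinState.vec, le_of_lt]
  obtain ⟨i, hi⟩ := Function.ne_iff.mp hy
  exact Finset.sum_lt_sum (fun i _ => (hle i).1) ⟨i, Finset.mem_univ i, (hle i).2 hi⟩

/-- A two-layer network of linear threshold units is realized by its hidden units. -/
theorem realizable_of_threshold_network {k n : ℕ} {ι : Type} [Fintype ι]
    {f : BinState k → BinState n} {g : ι → BinState k → Bool} (hg : ∀ j, IsLinearThreshold (g j))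
    (W : ι → Fin n → ℝ) (b : Fin n → ℝ)
    (h : ∀ x i, 0 < boolSign (f x i) * (b i + ∑ j, if g j x then W j i else 0)) :
    Realizable ι f := by
  choose v c hv using hg
  -- For `K` this large, the output weights cannot change the sign of a preactivation; nonvanishing
  -- of the affine functions on the cube is essential here.
  have hK : ∀ᶠ K : ℝ in Filter.atTop, ∀ j x y,
      |W j ⬝ᵥ BinState.vec y| ≤ K * |v j ⬝ᵥ BinState.vec x + c j| := by
    simp only [Filter.eventually_all]
    intro j x y
    exact (Filter.tendsto_id.atTop_mul_const (abs_pos.mpr (hv j x).1)).eventually_ge_atTop _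
  obtain ⟨K, hK⟩ := hK.exists
  refine ⟨fun j => K • v j, W, fun j => K * c j, b, fun x y hy => ?_⟩
  set T : ι → ℝ := fun j => v j ⬝ᵥ x.vec + c j with hT
  have hscore : ∀ y : BinState n, score (fun j => K • v j) W (fun j => K * c j) b x y =
      (fun i => b i + ∑ j, if g j x then W j i else 0) ⬝ᵥ y.vec +
        ∑ j, if g j x then K * T j else 0 := by
    intro y
    have hunit : ∀ j, max 0 ((K • v j) ⬝ᵥ x.vec + W j ⬝ᵥ y.vec + K * c j) =
        (if g j x then W j ⬝ᵥ y.vec else 0) + if g j x then K * T j else 0 := by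
      intro j
      have e : (K • v j) ⬝ᵥ x.vec + W j ⬝ᵥ y.vec + K * c j = W j ⬝ᵥ y.vec + K * T j := by
        simp only [hT, smul_dotProduct, smul_eq_mul]; ring
      have hb := abs_le.mp (hK j x y)
      rw [e]
      by_cases hpos : 0 < T j
      · rw [if_pos ((hv j x).2.mpr hpos), if_pos ((hv j x).2.mpr hpos)]
        rw [abs_of_pos hpos] at hb
        exact max_eq_right (by linarith)
      · have hg' : ¬ g j x = true := fun hh => hpos ((hv j x).2.mp hh)
        rw [if_neg hg', if_neg hg', add_zero]
        rw [abs_of_nonpos (not_lt.mp hpos)] at hb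
        exact max_eq_left (by linarith)
    have hlin : (fun i => b i + ∑ j, if g j x then W j i else 0) ⬝ᵥ y.vec =
        b ⬝ᵥ y.vec + ∑ j, if g j x then W j ⬝ᵥ y.vec else 0 := by
      simp only [dotProduct, add_mul, Finset.sum_add_distrib, Finset.sum_mul]
      rw [Finset.sum_comm]
      congr 1
      refine Finset.sum_congr rfl fun j _ => ?_
      split_ifs <;> simp
    rw [hlin]
    unfold score
    simp only [hunit, Finset.sum_add_distrib]
    ring
  rw [hscore, hscore]
  gcongr
  exact score_lt_of_sign _ _ _ (h x) hy

/-- Weighted Hamming distances from a point of the cube are affine functions. -/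
theorem isLinearThreshold_of_distance {k : ℕ} (a : BinState k) (w : Fin k → ℝ) (r : ℝ)
    {g : BinState k → Bool}
    (h : ∀ x, r - ∑ i, (if x i = a i then 0 else w i) ≠ 0 ∧
      (g x = true ↔ 0 < r - ∑ i, if x i = a i then 0 else w i)) : IsLinearThreshold g := by
  refine ⟨fun i => if a i then w i else -w i, r - ∑ i, if a i then w i else 0, fun x => ?_⟩
  have e : (fun i => if a i then w i else -w i) ⬝ᵥ x.vec + (r - ∑ i, if a i then w i else 0) =
      r - ∑ i, if x i = a i then 0 else w i := by
    rw [dotProduct, sub_eq_add_neg, sub_eq_add_neg, add_left_comm, ← Finset.sum_neg_distrib,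
      ← Finset.sum_neg_distrib, ← Finset.sum_add_distrib]
    congr 1
    refine Finset.sum_congr rfl fun i _ => ?_
    unfold BinState.vec
    cases x i <;> cases a i <;> simp
  rw [e]
  exact h x

/-- Negation of the `i`-th unit. -/
def flipAt {k : ℕ} (a : BinState k) (i : Fin k) : BinState k := Function.update a i (!(a i))

theorem flipAt_ne {k : ℕ} (a : BinState k) (i : Fin k) : flipAt a i ≠ a := by
  intro h
  have := congrFun h i
  simp [flipAt] at this

theorem sum_ite_flipAt {k : ℕ} (a : BinState k) (i : Fin k) (w : Fin k → ℝ) :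
    (∑ j, if flipAt a i j = a j then 0 else w j) = w i := by
  rw [Finset.sum_eq_single i]
  · simp [flipAt]
  · intro j _ hj
    simp [flipAt, hj]
  · simp

theorem flipAt_trichotomy {k : ℕ} (a x : BinState k) :
    x = a ∨ (∃ i, x = flipAt a i) ∨ ∃ i j, i ≠ j ∧ x i ≠ a i ∧ x j ≠ a j := by
  by_cases h0 : x = a
  · exact .inl h0
  obtain ⟨i, hi⟩ := Function.ne_iff.mp h0
  by_cases h1 : ∃ j, i ≠ j ∧ x j ≠ a j
  · obtain ⟨j, hij, hj⟩ := h1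
    exact .inr (.inr ⟨i, j, hij, hi, hj⟩)
  · push Not at h1
    refine .inr (.inl ⟨i, funext fun j => ?_⟩)
    by_cases hj : j = i
    · subst hj
      simp only [flipAt, Function.update_self]
      revert hi
      cases x j <;> cases a j <;> simp
    · rw [h1 j (Ne.symm hj)]
      simp [flipAt, hj]

-- In the weighted Hamming distance from `a` with weight 1 on `S` and 2 elsewhere, the star is the
-- ball of radius 3/2: any two flips already cost at least 2.
open Classical in
theorem isLinearThreshold_star {k : ℕ} (a : BinState k) (S : Fin k → Prop) :
    IsLinearThreshold fun x => decide (x = a ∨ ∃ i, S i ∧ x = flipAt a i) := by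
  refine isLinearThreshold_of_distance a (fun i => if S i then 1 else 2) (3 / 2) fun x => ?_
  rcases flipAt_trichotomy a x with rfl | ⟨i, rfl⟩ | ⟨i, j, hij, hi, hj⟩
  · norm_num
  · rw [sum_ite_flipAt]
    have hiff : (∃ j, S j ∧ flipAt a i = flipAt a j) ↔ S i := by
      refine ⟨?_, fun h => ⟨i, h, rfl⟩⟩
      rintro ⟨j, hj, e⟩
      have : i = j := by
        by_contra hne
        have := congrFun e i
        simp [flipAt, hne] at this
      exact this ▸ hj
    by_cases hS : S i
    · simp [hS, flipAt_ne, hiff]; norm_num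
    · simp [hS, flipAt_ne, hiff]; norm_num
  · have hsum : 2 ≤ ∑ l, if x l = a l then (0 : ℝ) else if S l then 1 else 2 := by
      have h1 : ∑ l ∈ {i, j}, (if x l = a l then (0 : ℝ) else if S l then 1 else 2) ≤
          ∑ l, if x l = a l then (0 : ℝ) else if S l then 1 else 2 :=
        Finset.sum_le_sum_of_subset_of_nonneg (Finset.subset_univ _) fun l _ _ => by
          split_ifs <;> norm_num
      rw [Finset.sum_pair hij, if_neg hi, if_neg hj] at h1
      have h2 : ∀ l, (1 : ℝ) ≤ if S l then 1 else 2 := fun l => by split_ifs <;> norm_num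
      linarith [h2 i, h2 j]
    have hfalse : ¬ (x = a ∨ ∃ l, S l ∧ x = flipAt a l) := by
      rintro (rfl | ⟨l, _, rfl⟩)
      · exact hi rfl
      · have : ∀ p, flipAt a l p ≠ a p → p = l := by
          intro p hp
          by_contra hne
          exact hp (by simp [flipAt, hne])
        exact hij ((this i hi).trans (this j hj).symm)
    simp only [decide_eq_true_eq, hfalse, false_iff, not_lt]
    constructor
    · linarith
    · linarith

theorem isLinearThreshold_singleton {k : ℕ} (a : BinState k) :
    IsLinearThreshold fun x => decide (x = a) := by
  have := isLinearThreshold_star a (fun _ => False)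
  simpa using this

/-- Each nonzero input gets a unit that detects it and corrects the output biases, which encode the
value at the zero input. -/
theorem realizable_card_sub_one {k n : ℕ} (f : BinState k → BinState n) :
    Realizable {x : BinState k // x ≠ fun _ => false} f := by
  set x₀ : BinState k := fun _ => false with hx₀
  refine realizable_of_threshold_network
    (g := fun (a : {x : BinState k // x ≠ x₀}) x => decide (x = a))
    (fun a => isLinearThreshold_singleton a.1)
    (fun a i => boolSign (f a i) - boolSign (f x₀ i)) (fun i => boolSign (f x₀ i)) fun x i => ?_
  have hsq : ∀ s, 0 < boolSign s * boolSign s := by intro s; cases s <;> simp [boolSign]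
  by_cases hx : x = x₀
  · subst hx
    rw [Finset.sum_eq_zero]
    · simpa using hsq _
    · intro a _
      simp [a.2.symm]
  · rw [Finset.sum_eq_single ⟨x, hx⟩]
    · simpa using hsq _
    · intro a _ ha
      have : x ≠ a := fun e => ha (Subtype.ext e.symm)
      simp [this]
    · simp

/-! ### Covering codes and depth-two threshold circuits -/

/-- A covering code of radius one, from the fibres of a syndrome map. -/
theorem exists_covering_code (k : ℕ) :
    ∃ C : Finset (BinState k), C.card * (k + 2) ≤ 2 * 2 ^ k ∧
      ∀ x, ∃ a ∈ C, x = a ∨ ∃ i, x = flipAt a i := by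
  classical
  set r := Nat.log 2 (k + 1) with hr
  have hr1 : 2 ^ r ≤ k + 1 := Nat.pow_log_le_self 2 (by omega)
  have hr2 : k + 1 < 2 ^ (r + 1) := Nat.lt_pow_succ_log_self (by norm_num) _
  let G := Fin r → ZMod 2
  have hG : Fintype.card G = 2 ^ r := by simp [G, ZMod.card]
  -- The `2 ^ r - 1` nonzero syndromes fit into `k` coordinates; the unused coordinates receive
  -- syndrome 0. Flipping one coordinate can then move any syndrome to any other, so every fibre is
  -- a covering code.
  have hne : Nonempty ({g : G // g ≠ 0} ↪ Fin k) := by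
    apply Function.Embedding.nonempty_of_card_le
    rw [Fintype.card_subtype_compl, hG]
    simp; omega
  obtain ⟨e⟩ := hne
  let φ : Fin k → G := Function.extend e Subtype.val 0
  have hφ : ∀ t, φ (e t) = t.1 := fun t => e.injective.extend_apply _ _ _
  let H : BinState k → G := fun x => ∑ i, if x i then φ i else 0
  have hself : ∀ g : G, g + g = 0 := fun g => funext fun i => CharTwo.add_self_eq_zero (g i)
  have hflip : ∀ x i, H (flipAt x i) = H x + φ i := by
    intro x i
    simp only [H]
    rw [← Finset.add_sum_erase _ _ (Finset.mem_univ i),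
      ← Finset.add_sum_erase Finset.univ (fun j => if x j then φ j else 0) (Finset.mem_univ i)]
    have : ∑ j ∈ Finset.univ.erase i, (if flipAt x i j then φ j else 0) =
        ∑ j ∈ Finset.univ.erase i, if x j then φ j else 0 :=
      Finset.sum_congr rfl fun j hj => by simp [flipAt, Finset.ne_of_mem_erase hj]
    rw [this]
    cases hx : x i
    · simp [flipAt, hx, add_comm]
    · simp only [flipAt, Function.update_self, hx, Bool.not_true, Bool.false_eq_true, if_false,
        if_true, zero_add]
      rw [add_right_comm, hself, zero_add]
  -- Pigeonhole: some fibre has at most the average size `2 ^ k / 2 ^ r`, and `k + 2 ≤ 2 ^ (r + 1)`.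
  obtain ⟨s, -, hs⟩ : ∃ s ∈ (Finset.univ : Finset G),
      (Finset.univ.filter fun x => H x = s).card * 2 ^ r ≤ 2 ^ k := by
    by_contra! hcon
    have h1 := Finset.card_eq_sum_card_fiberwise (s := (Finset.univ : Finset (BinState k)))
      (t := Finset.univ) (f := H) (by simp)
    have h2 : ∑ s : G, 2 ^ k < ∑ s : G, (Finset.univ.filter fun x => H x = s).card * 2 ^ r :=
      Finset.sum_lt_sum_of_nonempty Finset.univ_nonempty hcon
    rw [← Finset.sum_mul, ← h1] at h2
    simp only [Finset.sum_const, Finset.card_univ, hG, smul_eq_mul] at h2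
    simp [mul_comm] at h2
  refine ⟨Finset.univ.filter fun x => H x = s, ?_, fun x => ?_⟩
  · rw [pow_succ] at hr2
    nlinarith
  · by_cases hx : H x = s
    · exact ⟨x, by simp [hx], .inl rfl⟩
    · have ht : H x - s ≠ 0 := sub_ne_zero.mpr hx
      refine ⟨flipAt x (e ⟨H x - s, ht⟩), ?_, .inr ⟨e ⟨H x - s, ht⟩, ?_⟩⟩
      · simp only [Finset.mem_filter, Finset.mem_univ, true_and, hflip, hφ]
        rw [← add_sub_assoc, hself, zero_sub]
        exact neg_eq_of_add_eq_zero_left (hself s)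
      · funext j
        by_cases hj : j = e ⟨H x - s, ht⟩ <;> simp [flipAt, hj]

/-- `f` is computed by a linear threshold unit on top of linear threshold units
indexed by `ι`. -/
def HasThresholdDepthTwo {k : ℕ} (f : BinState k → Bool) (ι : Type) [Fintype ι] : Prop :=
  ∃ (g : ι → BinState k → Bool) (w : ι → ℝ) (b : ℝ), (∀ j, IsLinearThreshold (g j)) ∧
    ∀ x, 0 < boolSign (f x) * (b + ∑ j, if g j x then w j else 0)

theorem HasThresholdDepthTwo.not {k : ℕ} {f : BinState k → Bool} {ι : Type} [Fintype ι]
    (h : HasThresholdDepthTwo (fun x => !(f x)) ι) : HasThresholdDepthTwo f ι := by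
  obtain ⟨g, w, b, hg, h⟩ := h
  refine ⟨g, -w, -b, hg, fun x => ?_⟩
  have e : (∑ j, if g j x then (-w) j else 0) = -∑ j, if g j x then w j else 0 := by
    rw [← Finset.sum_neg_distrib]
    refine Finset.sum_congr rfl fun j _ => ?_
    split_ifs <;> simp
  have := h x
  rw [e]
  cases hf : f x <;> simp [hf, boolSign] at this ⊢ <;> linarith

-- Each codeword gets a star unit of weight 1 on itself and its neighbours where `f` is true. A star
-- always contains its centre, so centres with `f` false need a cancelling unit of weight -1. The
-- sum counts the codewords covering `x` if `f x` is true and is 0 otherwise, whence the threshold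
-- 1/2.
open Classical in
theorem hasThresholdDepthTwo_of_covering {k : ℕ} {C : Finset (BinState k)}
    (hC : ∀ x, ∃ a ∈ C, x = a ∨ ∃ i, x = flipAt a i) (f : BinState k → Bool) :
    HasThresholdDepthTwo f ((C : Type) ⊕ {a : C // f a = false}) := by
  have hstar : ∀ a, IsLinearThreshold
      (fun x => decide (x = a ∨ ∃ i, f (flipAt a i) = true ∧ x = flipAt a i)) :=
    fun a => by convert isLinearThreshold_star a (fun i => f (flipAt a i) = true)
  refine ⟨Sum.elim (fun a x => decide (x = a ∨ ∃ i, f (flipAt a i) = true ∧ x = flipAt a i))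
    (fun a x => decide (x = a)), Sum.elim (fun _ => 1) (fun _ => -1), -1 / 2, ?_, fun x => ?_⟩
  · rintro (a | a)
    · exact hstar a.1
    · exact isLinearThreshold_singleton a.1.1
  have hsub : (∑ a : {a : C // f a = false}, if x = a.1.1 then (-1 : ℝ) else 0) =
      ∑ a : C, if f a = false then if x = a.1 then (-1 : ℝ) else 0 else 0 := by
    refine Eq.trans ?_ (Finset.sum_filter _ _)
    exact (Finset.sum_subtype (p := fun a : C => f a = false)
      (Finset.univ.filter fun a : C => f a = false) (by simp)
      (fun a : C => if x = a.1 then (-1 : ℝ) else 0)).symm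
  have hterm : ∀ a : C, ((if x = a.1 ∨ ∃ i, f (flipAt a i) = true ∧ x = flipAt a i
      then (1 : ℝ) else 0) + if f a = false then if x = a.1 then (-1 : ℝ) else 0 else 0) =
      if f x = true ∧ (x = a.1 ∨ ∃ i, x = flipAt a i) then 1 else 0 := by
    intro a
    by_cases hxa : x = a.1
    · subst hxa
      cases hf : f a <;> simp
    · have : (∃ i, f (flipAt a i) = true ∧ x = flipAt a i) ↔
          f x = true ∧ ∃ i, x = flipAt a i := by
        constructor
        · rintro ⟨i, hi, rfl⟩
          exact ⟨hi, i, rfl⟩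
        · rintro ⟨hx, i, rfl⟩
          exact ⟨i, hx, rfl⟩
      simp [hxa, this]
  have htotal : (∑ j, if (Sum.elim
      (fun (a : C) x => decide (x = a.1 ∨ ∃ i, f (flipAt a i) = true ∧ x = flipAt a i))
      (fun (a : {a : C // f a = false}) x => decide (x = a.1.1))) j x then
      (Sum.elim (fun _ => (1 : ℝ)) (fun _ => -1)) j else 0) =
      ∑ a : C, if f x = true ∧ (x = a.1 ∨ ∃ i, x = flipAt a i) then (1 : ℝ) else 0 := by
    rw [Fintype.sum_sum_type]
    simp only [Sum.elim_inl, Sum.elim_inr, decide_eq_true_eq]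
    rw [hsub, ← Finset.sum_add_distrib]
    exact Finset.sum_congr rfl fun a _ => hterm a
  rw [htotal]
  cases hf : f x
  · norm_num [boolSign]
  · obtain ⟨a, haC, ha⟩ := hC x
    have := Finset.single_le_sum (f := fun a : C =>
      if true = true ∧ (x = a.1 ∨ ∃ i, x = flipAt a i) then (1 : ℝ) else 0)
      (fun a _ => by split_ifs <;> norm_num) (Finset.mem_univ ⟨a, haC⟩)
    simp only [true_and, ha, if_true] at this
    simp only [boolSign, if_true, true_and]
    linarith

theorem exists_hasThresholdDepthTwo {k : ℕ} (f : BinState k → Bool) :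
    ∃ N : ℕ, N * (k + 2) ≤ 3 * 2 ^ k ∧ HasThresholdDepthTwo f (Fin N) := by
  classical
  obtain ⟨C, hcard, hC⟩ := exists_covering_code k
  -- If at most half the codewords need cancelling, `3 / 2 * C.card` units suffice; otherwise this
  -- holds for the negation of `f`.
  have key : ∀ f : BinState k → Bool,
      2 * Fintype.card {a : C // f a = false} ≤ C.card →
      ∃ N : ℕ, N * (k + 2) ≤ 3 * 2 ^ k ∧ HasThresholdDepthTwo f (Fin N) := by
    intro f hf
    obtain ⟨g, w, b, hg, h⟩ := hasThresholdDepthTwo_of_covering hC f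
    have e := Fintype.equivFin ((C : Type) ⊕ {a : C // f a = false})
    refine ⟨_, ?_, g ∘ e.symm, w ∘ e.symm, b, fun j => hg _, fun x => ?_⟩
    · rw [Fintype.card_sum, Fintype.card_coe]
      nlinarith
    · have := e.symm.sum_comp (fun j => if g j x then w j else 0)
      simp only [Function.comp_apply, this]
      exact h x
  have hsplit : Fintype.card {a : C // f a = false} + Fintype.card {a : C // (!f a) = false} =
      C.card := by
    have := Fintype.card_subtype_compl (fun a : C => f a = false)
    have hle := Fintype.card_subtype_le (fun a : C => f a = false)
    rw [Fintype.card_coe] at this hle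
    have e : Fintype.card {a : C // (!f a) = false} = Fintype.card {a : C // ¬ f a = false} :=
      Fintype.card_congr (Equiv.subtypeEquivRight (by simp))
    omega
  rcases le_total (Fintype.card {a : C // f a = false})
    (Fintype.card {a : C // (!f a) = false}) with h | h
  · exact key f (by omega)
  · obtain ⟨N, hN, hf⟩ := key (fun x => !f x) (by omega)
    exact ⟨N, hN, hf.not⟩

/-- The circuits of the output bits use disjoint blocks of hidden units, each connected to its own
bit only. -/
theorem realizable_of_depthTwo {k n : ℕ} {f : BinState k → BinState n} {ι : Fin n → Type}
    [∀ i, Fintype (ι i)] (h : ∀ i, HasThresholdDepthTwo (fun x => f x i) (ι i)) :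
    Realizable (Σ i, ι i) f := by
  choose g w b hg h using h
  refine realizable_of_threshold_network (g := fun j => g j.1 j.2) (fun j => hg _ _)
    (fun j i => if j.1 = i then w j.1 j.2 else 0) b fun x i => ?_
  have e : (∑ j : Σ i, ι i, if g j.1 j.2 x then if j.1 = i then w j.1 j.2 else 0 else 0) =
      ∑ j, if g i j x then w i j else 0 := by
    rw [Fintype.sum_sigma, Finset.sum_eq_single i]
    · simp
    · intro i' _ hi'
      simp [hi']
    · simp
  rw [e]
  exact h i x

theorem realizable_of_le {k n m : ℕ}
    (hm : min ((2 : ℝ) ^ k - 1) (3 * (n : ℝ) / ((k : ℝ) + 2) * (2 : ℝ) ^ k) ≤ (m : ℝ))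
    (f : BinState k → BinState n) : Realizable (Fin m) f := by
  rcases min_le_iff.mp hm with hm | hm
  · have hcard : Fintype.card {x : BinState k // x ≠ fun _ => false} ≤ Fintype.card (Fin m) := by
      rw [Fintype.card_fin, Fintype.card_subtype_compl]
      have h1 : (2 : ℝ) ^ k ≤ (m + 1 : ℕ) := by push_cast; linarith
      have h2 : 2 ^ k ≤ m + 1 := by exact_mod_cast h1
      simpa using h2
    obtain ⟨e⟩ := Function.Embedding.nonempty_of_card_le hcard
    exact (realizable_card_sub_one f).of_embedding e
  · choose N hN hf using fun i => exists_hasThresholdDepthTwo (fun x => f x i)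
    have hcard : Fintype.card (Σ i, Fin (N i)) ≤ Fintype.card (Fin m) := by
      rw [Fintype.card_sigma, Fintype.card_fin]
      simp only [Fintype.card_fin]
      have h1 : (∑ i, N i) * (k + 2) ≤ n * (3 * 2 ^ k) := by
        rw [Finset.sum_mul]
        simpa using Finset.sum_le_sum fun i (_ : i ∈ Finset.univ) => hN i
      have h2 : 3 * (n : ℝ) * 2 ^ k ≤ m * (k + 2) := by
        rwa [div_mul_eq_mul_div, div_le_iff₀ (by positivity)] at hm
      have h3 : n * (3 * 2 ^ k) ≤ m * (k + 2) := by
        have : (n : ℝ) * (3 * 2 ^ k) ≤ m * (k + 2) := by linarith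
        exact_mod_cast this
      exact Nat.le_of_mul_le_mul_right (h1.trans h3) (by omega)
    obtain ⟨e⟩ := Function.Embedding.nonempty_of_card_le hcard
    exact (realizable_of_depthTwo hf).of_embedding e

/-! ### Counting sign patterns of linear functionals -/

/-- The patterns of strict positivity of finitely many linear functionals. -/
noncomputable def positivitySets {ι E : Type*} [Fintype ι] [AddCommGroup E] [Module ℝ E]
    (L : ι → E →ₗ[ℝ] ℝ) : Finset (Finset ι) := by
  classical exact Finset.univ.filter fun s => ∃ v, ∀ i, i ∈ s ↔ 0 < L i v

theorem mem_positivitySets {ι E : Type*} [Fintype ι] [AddCommGroup E] [Module ℝ E]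
    {L : ι → E →ₗ[ℝ] ℝ} {s : Finset ι} :
    s ∈ positivitySets L ↔ ∃ v, ∀ i, i ∈ s ↔ 0 < L i v := by
  simp [positivitySets]

theorem filter_mem_positivitySets {ι E : Type*} [Fintype ι] [AddCommGroup E] [Module ℝ E]
    (L : ι → E →ₗ[ℝ] ℝ) (v : E) [DecidablePred fun i => 0 < L i v] :
    Finset.univ.filter (fun i => 0 < L i v) ∈ positivitySets L :=
  mem_positivitySets.mpr ⟨v, by simp⟩

/-- Shattered functionals are linearly independent. Otherwise take a relation with a positive
coefficient and a `v` at which exactly the functionals with positive coefficients are positive: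
every term is then nonnegative and one is positive, so the sum is not 0. -/
theorem card_le_finrank_of_shatters {ι E : Type*} [Fintype ι] [DecidableEq ι] [AddCommGroup E]
    [Module ℝ E] [Module.Finite ℝ E] {L : ι → E →ₗ[ℝ] ℝ} {s : Finset ι}
    (h : (positivitySets L).Shatters s) : s.card ≤ Module.finrank ℝ E := by
  have hli : LinearIndependent ℝ (fun i : s => L i) := by
    rw [Fintype.linearIndependent_iff]
    by_contra hne
    push Not at hne
    have hpos : ∃ g : s → ℝ, ∑ i, g i • L i = 0 ∧ ∃ i, 0 < g i := by
      obtain ⟨g, hg, i, hi⟩ := hne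
      rcases lt_or_gt_of_ne hi with h | h
      · exact ⟨-g, by
          rw [← neg_zero, ← hg, ← Finset.sum_neg_distrib]
          exact Finset.sum_congr rfl fun i _ => neg_smul (g i) (L i), i, by simpa using h⟩
      · exact ⟨g, hg, i, h⟩
    obtain ⟨g, hg, i₀, hi₀⟩ := hpos
    obtain ⟨u, hu, hsu⟩ := h (t := (Finset.univ.filter fun i : s => 0 < g i).map
      (Function.Embedding.subtype _)) (by intro a; simp; intro h _; exact h)
    obtain ⟨v, hv⟩ := mem_positivitySets.mp hu
    have hiff : ∀ i : s, 0 < L i v ↔ 0 < g i := by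
      intro i
      rw [← hv]
      have := Finset.ext_iff.mp hsu i
      simpa using this
    have h0 : ∑ i, g i * L i v = 0 := by
      have := congrArg (fun l => l v) hg
      simpa using this
    have h1 : 0 < ∑ i, g i * L i v := by
      refine Finset.sum_pos' (fun i _ => ?_) ⟨i₀, Finset.mem_univ _, mul_pos hi₀ ((hiff i₀).mpr hi₀)⟩
      by_cases hi : 0 < g i
      · exact (mul_pos hi ((hiff i).mpr hi)).le
      · exact mul_nonneg_of_nonpos_of_nonpos (not_lt.mp hi)
          (not_lt.mp fun h => hi ((hiff i).mp h))
    exact h1.ne' h0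
  have := hli.fintype_card_le_finrank
  simpa [Subspace.dual_finrank_eq] using this

/-- The usual bound `(e * M / D) ^ D` with 3 in place of `e`: for `t = 3 / b ≤ 1`, multiplying the
sum by `t ^ D` gives at most `(1 + t) ^ M ≤ exp (t * M) ≤ 3 ^ D`. -/
theorem sum_choose_le_pow {M D : ℕ} {b : ℝ} (hb : 3 ≤ b) (hM : 3 * (M : ℝ) ≤ b * D) :
    ((∑ i ∈ Finset.Iic D, M.choose i : ℕ) : ℝ) ≤ b ^ D := by
  have hb0 : 0 < b := by linarith
  set t : ℝ := 3 / b with ht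
  have ht0 : 0 < t := by positivity
  have ht1 : t ≤ 1 := (div_le_one hb0).mpr hb
  have htM : t * M ≤ D := by
    rw [ht, div_mul_eq_mul_div, div_le_iff₀ hb0]; linarith
  have h1 : t ^ D * ((∑ i ∈ Finset.Iic D, M.choose i : ℕ) : ℝ) ≤ (t + 1) ^ M := by
    rw [add_pow]
    push_cast
    rw [Finset.mul_sum]
    calc ∑ i ∈ Finset.Iic D, t ^ D * (M.choose i : ℝ)
        ≤ ∑ i ∈ Finset.Iic D, t ^ i * (M.choose i : ℝ) := by
          refine Finset.sum_le_sum fun i hi => ?_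
          gcongr ?_ * _
          exact pow_le_pow_of_le_one ht0.le ht1 (Finset.mem_Iic.mp hi)
      _ ≤ ∑ i ∈ Finset.Iic D ∪ Finset.range (M + 1), t ^ i * (M.choose i : ℝ) :=
          Finset.sum_le_sum_of_subset_of_nonneg Finset.subset_union_left
            fun _ _ _ => by positivity
      _ = ∑ i ∈ Finset.range (M + 1), t ^ i * (M.choose i : ℝ) := by
          symm
          refine Finset.sum_subset Finset.subset_union_right fun i _ hi => ?_
          rw [Finset.mem_range, not_lt] at hi
          rw [Nat.choose_eq_zero_of_lt (by omega)]
          simp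
      _ = _ := by simp
  have h2 : (t + 1) ^ M ≤ 3 ^ D := by
    calc (t + 1) ^ M ≤ Real.exp t ^ M := by
          gcongr
          exact Real.add_one_le_exp t
      _ = Real.exp (t * M) := by rw [← Real.exp_nat_mul]; ring_nf
      _ ≤ Real.exp D := Real.exp_le_exp.mpr htM
      _ = Real.exp 1 ^ D := by rw [← Real.exp_nat_mul]; ring_nf
      _ ≤ 3 ^ D := by
          gcongr
          exact Real.exp_one_lt_three.le
  have h3 : t ^ D * b ^ D = 3 ^ D := by
    rw [← mul_pow, ht, div_mul_cancel₀ _ hb0.ne']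
  have h4 := h1.trans (h2.trans_eq h3.symm)
  exact le_of_mul_le_mul_left h4 (by positivity)

/-- Sauer–Shelah, with the dimension bounding the VC dimension. -/
theorem card_positivitySets_le {ι E : Type*} [Fintype ι] [AddCommGroup E] [Module ℝ E]
    [Module.Finite ℝ E] (L : ι → E →ₗ[ℝ] ℝ) {D : ℕ} (hD : Module.finrank ℝ E = D) {b : ℝ}
    (hb : 3 ≤ b) (hM : 3 * (Fintype.card ι : ℝ) ≤ b * D) :
    ((positivitySets L).card : ℝ) ≤ b ^ D := by
  classical
  refine le_trans ?_ (sum_choose_le_pow hb hM)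
  norm_cast
  refine (Finset.card_le_card_shatterer _).trans
    ((Finset.card_shatterer_le_sum_vcDim).trans ?_)
  refine Finset.sum_le_sum_of_subset (Finset.Iic_subset_Iic.mpr ?_)
  refine Finset.sup_le fun s hs => ?_
  rw [← hD]
  exact card_le_finrank_of_shatters (Finset.mem_shatterer.mp hs)

/-! ### Counting the realizable functions -/

/-- The parameters of one hidden unit. -/
abbrev UnitParams (k n : ℕ) : Type := (Fin k → ℝ) × (Fin n → ℝ) × ℝ

/-- The input of a hidden unit, as a linear functional of its parameters. -/
noncomputable def preactivation {k n : ℕ} (p : BinState k × BinState n) : UnitParams k n →ₗ[ℝ] ℝ where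
  toFun u := u.1 ⬝ᵥ p.1.vec + u.2.1 ⬝ᵥ p.2.vec + u.2.2
  map_add' u v := by simp [add_dotProduct]; ring
  map_smul' r u := by simp [smul_dotProduct]; ring

/-- The score for a prescribed pattern of active hidden units, as a linear functional of the
parameters. -/
noncomputable def patternScore {k n m : ℕ} (σ : Fin m → Finset (BinState k × BinState n))
    (p : BinState k × BinState n) : (Fin m → UnitParams k n) × (Fin n → ℝ) →ₗ[ℝ] ℝ where
  toFun θ := θ.2 ⬝ᵥ p.2.vec + ∑ j, if p ∈ σ j then preactivation p (θ.1 j) else 0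
  map_add' θ η := by
    have : ∀ j, (if p ∈ σ j then preactivation p ((θ + η).1 j) else 0) =
        (if p ∈ σ j then preactivation p (θ.1 j) else 0) +
          (if p ∈ σ j then preactivation p (η.1 j) else 0) := by
      intro j; split_ifs <;> simp
    simp only [this, Finset.sum_add_distrib, Prod.snd_add, add_dotProduct]
    ring
  map_smul' r θ := by
    have : ∀ j, (if p ∈ σ j then preactivation p ((r • θ).1 j) else 0) =
        r * (if p ∈ σ j then preactivation p (θ.1 j) else 0) := by
      intro j; split_ifs <;> simp
    simp only [this, ← Finset.mul_sum, Prod.smul_snd, smul_dotProduct, smul_eq_mul,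
      RingHom.id_apply]
    ring

theorem finrank_unitParams (k n : ℕ) : Module.finrank ℝ (UnitParams k n) = n + k + 1 := by
  simp; ring

theorem finrank_params (k n m : ℕ) :
    Module.finrank ℝ ((Fin m → UnitParams k n) × (Fin n → ℝ)) = m * (n + k + 1) + n := by
  rw [Module.finrank_prod, Module.finrank_pi_fintype]
  simp [finrank_unitParams, -Module.finrank_prod]

/-- Pairs of distinct outputs, each listed in one order only. -/
abbrev OutputPair (n : ℕ) : Type :=
  {p : BinState n × BinState n //
    Fintype.equivFin (BinState n) p.1 < Fintype.equivFin (BinState n) p.2}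

theorem two_mul_card_outputPair_le (n : ℕ) : 2 * Fintype.card (OutputPair n) ≤ 2 ^ (2 * n) := by
  let g : OutputPair n ⊕ OutputPair n → BinState n × BinState n :=
    Sum.elim (fun p => p.1) (fun p => p.1.swap)
  have hg : Function.Injective g := by
    rintro (⟨p, hp⟩ | ⟨p, hp⟩) (⟨q, hq⟩ | ⟨q, hq⟩) h <;> simp [g] at h ⊢
    · exact h
    · subst h; exact absurd hp (not_lt.mpr (by simpa using hq.le))
    · subst h; exact absurd hp (not_lt.mpr (by simpa using hq.le))
    · exact h
  have := Fintype.card_le_of_injective g hg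
  simp only [Fintype.card_sum, Fintype.card_prod, Fintype.card_fun, Fintype.card_bool,
    Fintype.card_fin] at this
  rw [two_mul, two_mul, pow_add]
  exact this

/-- Each `f` is encoded by the activation pattern `σ f` and the signs `τ f` of score differences.
Recording `σ f` makes `τ f` a sign pattern of linear functionals, so both can be counted: each unit
separately in dimension `n + k + 1`, the comparisons in the full parameter space. -/
theorem two_pow_le_of_realizable {k n m : ℕ}
    (h : ∀ f : BinState k → BinState n, Realizable (Fin m) f) {b₁ b₂ : ℝ} (hb₁ : 3 ≤ b₁)
    (hb₂ : 3 ≤ b₂) (h₁ : 3 * 2 ^ (n + k) ≤ b₁ * (n + k + 1 : ℕ))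
    (h₂ : 3 * 2 ^ (k + 2 * n) ≤ 2 * b₂ * (m * (n + k + 1) + n : ℕ)) :
    (2 : ℝ) ^ (n * 2 ^ k) ≤ (b₁ ^ (n + k + 1)) ^ m * b₂ ^ (m * (n + k + 1) + n) := by
  classical
  choose V W c b hf using h
  let Θ : (BinState k → BinState n) → (Fin m → UnitParams k n) × (Fin n → ℝ) :=
    fun f => (fun j => (V f j, W f j, c f j), b f)
  let σ : (BinState k → BinState n) → Fin m → Finset (BinState k × BinState n) :=
    fun f j => Finset.univ.filter fun p => 0 < preactivation p ((Θ f).1 j)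
  let Λ : (Fin m → Finset (BinState k × BinState n)) → BinState k × OutputPair n →
      ((Fin m → UnitParams k n) × (Fin n → ℝ) →ₗ[ℝ] ℝ) :=
    fun s q => patternScore s (q.1, q.2.1.1) - patternScore s (q.1, q.2.1.2)
  let τ : (BinState k → BinState n) → Finset (BinState k × OutputPair n) :=
    fun f => Finset.univ.filter fun q => 0 < Λ (σ f) q (Θ f)
  have hscore : ∀ f x y, patternScore (σ f) (x, y) (Θ f) = score (V f) (W f) (c f) (b f) x y := by
    intro f x y
    change (b f) ⬝ᵥ y.vec + (∑ j, if (x, y) ∈ σ f j then preactivation (x, y) ((Θ f).1 j) else 0) = _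
    unfold score
    congr 1
    refine Finset.sum_congr rfl fun j _ => ?_
    have e : preactivation (x, y) ((Θ f).1 j) =
      V f j ⬝ᵥ x.vec + W f j ⬝ᵥ y.vec + c f j := rfl
    by_cases hp : 0 < preactivation (x, y) ((Θ f).1 j)
    · rw [if_pos (by simpa [σ] using hp), ← e, max_eq_right hp.le]
    · rw [if_neg (by simpa [σ] using hp), ← e, max_eq_left (not_lt.mp hp)]
  let A : Finset (Finset (BinState k × BinState n)) :=
    positivitySets (preactivation (k := k) (n := n))
  let B : Finset (Σ _ : Fin m → Finset (BinState k × BinState n),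
      Finset (BinState k × OutputPair n)) :=
    (Fintype.piFinset fun _ : Fin m => A).sigma fun s => positivitySets (Λ s)
  have hmaps : ∀ f, (⟨σ f, τ f⟩ : Σ _ : Fin m → Finset (BinState k × BinState n),
      Finset (BinState k × OutputPair n)) ∈ B := by
    intro f
    refine Finset.mem_sigma.mpr ⟨Fintype.mem_piFinset.mpr fun j => ?_, ?_⟩
    · exact filter_mem_positivitySets _ _
    · exact filter_mem_positivitySets _ _
  -- At an input where `f` and `g` differ, the comparison of `f x` with `g x` is won strictly under
  -- the parameters of `f` and lost under those of `g`. One order per pair is enough, which halves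
  -- the number of functionals.
  have hsep : ∀ f g, σ f = σ g → τ f = τ g → ∀ x,
      ¬ Fintype.equivFin (BinState n) (f x) < Fintype.equivFin (BinState n) (g x) := by
    intro f g hσ hτ x hlt
    have hne : f x ≠ g x := fun e => by simp [e] at hlt
    let q : BinState k × OutputPair n := (x, ⟨(f x, g x), hlt⟩)
    have hΛ : ∀ f', Λ (σ f') q (Θ f') = score (V f') (W f') (c f') (b f') x (f x) -
        score (V f') (W f') (c f') (b f') x (g x) := by
      intro f'
      rw [← hscore, ← hscore]; rfl
    have h1 : q ∈ τ f := by
      simp only [τ, Finset.mem_filter, Finset.mem_univ, true_and, hΛ, sub_pos]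
      exact hf f x _ hne.symm
    have h2 : q ∉ τ g := by
      simp only [τ, Finset.mem_filter, Finset.mem_univ, true_and, hΛ, sub_pos, not_lt]
      exact (hf g x _ hne).le
    exact h2 (hτ ▸ h1)
  have hinj : Function.Injective (fun f => (⟨σ f, τ f⟩ :
      Σ _ : Fin m → Finset (BinState k × BinState n), Finset (BinState k × OutputPair n))) := by
    intro f g hfg
    simp only [Sigma.mk.injEq, heq_eq_eq] at hfg
    funext x
    apply (Fintype.equivFin (BinState n)).injective
    exact le_antisymm (not_lt.mp (hsep g f hfg.1.symm hfg.2.symm x))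
      (not_lt.mp (hsep f g hfg.1 hfg.2 x))
  have hcard : 2 ^ (n * 2 ^ k) ≤ B.card := by
    have := Finset.card_le_card_of_injOn (s := Finset.univ) (t := B) _
      (fun f _ => hmaps f) hinj.injOn
    simpa [pow_mul] using this
  have hA : (A.card : ℝ) ≤ b₁ ^ (n + k + 1) := by
    refine card_positivitySets_le _ (finrank_unitParams k n) hb₁ ?_
    refine le_of_eq_of_le ?_ h₁
    simp [pow_add, mul_comm]
  have hΛ : ∀ s, ((positivitySets (Λ s)).card : ℝ) ≤ b₂ ^ (m * (n + k + 1) + n) := by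
    intro s
    refine card_positivitySets_le _ (finrank_params k n m) hb₂ ?_
    have h3 : (2 * Fintype.card (OutputPair n) : ℝ) ≤ 2 ^ (2 * n) := by
      exact_mod_cast two_mul_card_outputPair_le n
    have h4 : (Fintype.card (BinState k × OutputPair n) : ℝ) =
        2 ^ k * Fintype.card (OutputPair n) := by
      rw [Fintype.card_prod]; simp
    rw [h4]
    rw [pow_add] at h₂
    nlinarith [pow_pos (show (0 : ℝ) < 2 by norm_num) k]
  calc (2 : ℝ) ^ (n * 2 ^ k) ≤ (B.card : ℝ) := by exact_mod_cast hcard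
    _ = ∑ s ∈ Fintype.piFinset fun _ : Fin m => A, ((positivitySets (Λ s)).card : ℝ) := by
        simp [B, Finset.card_sigma]
    _ ≤ ∑ s ∈ Fintype.piFinset fun _ : Fin m => A, b₂ ^ (m * (n + k + 1) + n) :=
        Finset.sum_le_sum fun s _ => hΛ s
    _ = (A.card : ℝ) ^ m * b₂ ^ (m * (n + k + 1) + n) := by
        simp [Fintype.card_piFinset]
    _ ≤ _ := by gcongr

/-! ### Numerical comparison with the claimed bound -/

theorem two_rpow_quarter (u : ℕ) : ((2 : ℝ) ^ ((u : ℝ) / 4)) ^ 4 = 2 ^ u := by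
  rw [← Real.rpow_natCast, ← Real.rpow_mul (by norm_num), ← Real.rpow_natCast]
  congr 1
  push_cast
  ring

/-- Bases of the form `2 ^ (u / 4)` turn the counting bound into an integer inequality after taking
fourth powers; `7 ≤ u` ensures a base of at least 3, since `3 ^ 4 ≤ 2 ^ 7`. -/
theorem four_mul_le_of_realizable {k n m : ℕ}
    (h : ∀ f : BinState k → BinState n, Realizable (Fin m) f) (u₁ u₂ : ℕ) (hu₁ : 7 ≤ u₁)
    (hu₂ : 7 ≤ u₂) (h₁ : (3 * 2 ^ (n + k)) ^ 4 ≤ 2 ^ u₁ * (n + k + 1) ^ 4)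
    (h₂ : (3 * 2 ^ (k + 2 * n)) ^ 4 ≤ 2 ^ u₂ * (2 * (m * (n + k + 1) + n)) ^ 4) :
    4 * (n * 2 ^ k) ≤ (n + k + 1) * m * u₁ + (m * (n + k + 1) + n) * u₂ := by
  have hb : ∀ u : ℕ, 7 ≤ u → (3 : ℝ) ≤ 2 ^ ((u : ℝ) / 4) := by
    intro u hu
    refine le_of_pow_le_pow_left₀ (n := 4) (by norm_num) (by positivity) ?_
    rw [two_rpow_quarter]
    calc (3 : ℝ) ^ 4 ≤ 2 ^ 7 := by norm_num
      _ ≤ 2 ^ u := pow_le_pow_right₀ (by norm_num) hu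
  have key := two_pow_le_of_realizable h (hb u₁ hu₁) (hb u₂ hu₂)
    (by
      refine le_of_pow_le_pow_left₀ (n := 4) (by norm_num) (by positivity) ?_
      rw [mul_pow (_ ^ (_ : ℝ)) _ 4, two_rpow_quarter]
      exact_mod_cast h₁)
    (by
      refine le_of_pow_le_pow_left₀ (n := 4) (by norm_num) (by positivity) ?_
      have e : ∀ t d : ℝ, 2 * t * d = t * (2 * d) := fun t d => by ring
      rw [e, mul_pow (_ ^ (_ : ℝ)) _ 4, two_rpow_quarter]
      exact_mod_cast h₂)
  have key4 := pow_le_pow_left₀ (by positivity) key 4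
  have e : ∀ (u d : ℕ), (((2 : ℝ) ^ ((u : ℝ) / 4)) ^ d) ^ 4 = 2 ^ (d * u) := by
    intro u d
    rw [pow_right_comm, two_rpow_quarter, ← pow_mul, mul_comm]
  rw [mul_pow, e, ← pow_mul _ (n + k + 1) m, e, ← pow_add, ← pow_mul] at key4
  have := (pow_le_pow_iff_right₀ (by norm_num : (1 : ℝ) < 2)).mp key4
  omega

theorem realizable_mono {k n n' m m' : ℕ}
    (h : ∀ f : BinState k → BinState n, Realizable (Fin m) f) (hn : n' ≤ n) (hm : m ≤ m')
    (f : BinState k → BinState n') : Realizable (Fin m') f := by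
  obtain ⟨d, rfl⟩ := Nat.exists_eq_add_of_le hn
  exact ((h _).restrict_output (d := d) (f := f)).of_embedding (Fin.castLEEmb hm)

theorem not_realizable_of_le {k n n' m m' : ℕ}
    (h : ∀ f : BinState k → BinState n, Realizable (Fin m) f) (hn : n' ≤ n) (hm : m ≤ m')
    (u₁ u₂ : ℕ)
    (hu : 7 ≤ u₁ ∧ 7 ≤ u₂ ∧ (3 * 2 ^ (n' + k)) ^ 4 ≤ 2 ^ u₁ * (n' + k + 1) ^ 4 ∧
      (3 * 2 ^ (k + 2 * n')) ^ 4 ≤ 2 ^ u₂ * (2 * (m' * (n' + k + 1) + n')) ^ 4 ∧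
      (n' + k + 1) * m' * u₁ + (m' * (n' + k + 1) + n') * u₂ < 4 * (n' * 2 ^ k)) : False :=
  (four_mul_le_of_realizable (realizable_mono h hn hm) u₁ u₂ hu.1 hu.2.1 hu.2.2.1
    hu.2.2.2.1).not_gt hu.2.2.2.2

theorem le_of_score_bound {k n m : ℕ} (M : ℕ)
    (hq : (2 * n * m + (n + k) ^ 2) ^ 2 < 4 * n ^ 2 * 2 ^ k)
    (hM : 4 * n ^ 2 * 2 ^ k ≤ (2 * n * (M + 1) + (n + k) ^ 2) ^ 2) : m ≤ M := by
  by_contra hm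
  have : M + 1 ≤ m := by omega
  exact absurd (hq.trans_le hM) (not_lt.mpr (by gcongr))

theorem not_lt_of_score_bound {k n m : ℕ}
    (hq : (2 * n * m + (n + k) ^ 2) ^ 2 < 4 * n ^ 2 * 2 ^ k)
    (hM : 4 * n ^ 2 * 2 ^ k ≤ ((n + k) ^ 2) ^ 2) : False :=
  absurd (hq.trans_le hM) (not_lt.mpr (by gcongr; omega))

theorem le_of_sq_bound {k m : ℕ} (M : ℕ) (hs : (m + 2 * k) ^ 2 < 2 ^ k)
    (hM : 2 ^ k ≤ (M + 1 + 2 * k) ^ 2) : m ≤ M := by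
  by_contra hm
  have : M + 1 ≤ m := by omega
  exact absurd (hs.trans_le hM) (not_lt.mpr (by gcongr))

/-- Here `hq` is the negated claim, squared, and `hs` is a weaker consequence free of `n`. From some
`n` on, `hs` bounds `m` uniformly and monotonicity reduces to a single instance; the finitely many
smaller `n` use `hq`. The two trailing numerals are the exponents `u₁` and `u₂`. -/
theorem not_realizable_of_lt_twenty {k n m : ℕ} (hk9 : 9 ≤ k) (hk20 : k < 20) (hn : 1 ≤ n)
    (h : ∀ f : BinState k → BinState n, Realizable (Fin m) f)
    (hq : (2 * n * m + (n + k) ^ 2) ^ 2 < 4 * n ^ 2 * 2 ^ k)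
    (hs : (m + 2 * k) ^ 2 < 2 ^ k) : False := by
  interval_cases k
  · rcases lt_or_ge n 2 with hw | hw
    · interval_cases n
      · exact not_lt_of_score_bound hq (by norm_num)
    · exact not_realizable_of_le h hw (le_of_sq_bound 4 hs (by norm_num)) 36 32 (by norm_num)
  · rcases lt_or_ge n 4 with hw | hw
    · interval_cases n
      · exact not_lt_of_score_bound hq (by norm_num)
      · exact not_lt_of_score_bound hq (by norm_num)
      · exact not_realizable_of_le h le_rfl (le_of_score_bound 3 hq (by norm_num)) 44 45
          (by norm_num)
    · exact not_realizable_of_le h hw (le_of_sq_bound 11 hs (by norm_num)) 47 45 (by norm_num)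
  · rcases lt_or_ge n 7 with hw | hw
    · interval_cases n
      · exact not_lt_of_score_bound hq (by norm_num)
      · exact not_realizable_of_le h le_rfl (le_of_score_bound 3 hq (by norm_num)) 44 41
          (by norm_num)
      · exact not_realizable_of_le h le_rfl (le_of_score_bound 12 hq (by norm_num)) 47 41
          (by norm_num)
      · exact not_realizable_of_le h le_rfl (le_of_score_bound 17 hq (by norm_num)) 51 46
          (by norm_num)
      · exact not_realizable_of_le h le_rfl (le_of_score_bound 19 hq (by norm_num)) 54 53
          (by norm_num)
      · exact not_realizable_of_le h le_rfl (le_of_score_bound 21 hq (by norm_num)) 58 60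
          (by norm_num)
    · exact not_realizable_of_le h hw (le_of_sq_bound 23 hs (by norm_num)) 62 68 (by norm_num)
  · rcases lt_or_ge n 5 with hw | hw
    · interval_cases n
      · exact not_lt_of_score_bound hq (by norm_num)
      · exact not_realizable_of_le h le_rfl (le_of_score_bound 14 hq (by norm_num)) 47 36
          (by norm_num)
      · exact not_realizable_of_le h le_rfl (le_of_score_bound 26 hq (by norm_num)) 51 40
          (by norm_num)
      · exact not_realizable_of_le h le_rfl (le_of_score_bound 31 hq (by norm_num)) 54 47
          (by norm_num)
    · exact not_realizable_of_le h hw (le_of_sq_bound 39 hs (by norm_num)) 58 53 (by norm_num)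
  · rcases lt_or_ge n 4 with hw | hw
    · interval_cases n
      · exact not_lt_of_score_bound hq (by norm_num)
      · exact not_realizable_of_le h le_rfl (le_of_score_bound 34 hq (by norm_num)) 51 34
          (by norm_num)
      · exact not_realizable_of_le h le_rfl (le_of_score_bound 47 hq (by norm_num)) 54 40
          (by norm_num)
    · exact not_realizable_of_le h hw (le_of_sq_bound 64 hs (by norm_num)) 58 46 (by norm_num)
  · rcases lt_or_ge n 3 with hw | hw
    · interval_cases n
      · exact not_realizable_of_le h le_rfl (le_of_score_bound 15 hq (by norm_num)) 51 35
          (by norm_num)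
      · exact not_realizable_of_le h le_rfl (le_of_score_bound 63 hq (by norm_num)) 54 35
          (by norm_num)
    · exact not_realizable_of_le h hw (le_of_sq_bound 99 hs (by norm_num)) 58 40 (by norm_num)
  · rcases lt_or_ge n 2 with hw | hw
    · interval_cases n
      · exact not_realizable_of_le h le_rfl (le_of_score_bound 53 hq (by norm_num)) 54 32
          (by norm_num)
    · exact not_realizable_of_le h hw (le_of_sq_bound 151 hs (by norm_num)) 58 33 (by norm_num)
  · rcases lt_or_ge n 2 with hw | hw
    · interval_cases n
      · exact not_realizable_of_le h le_rfl (le_of_score_bound 111 hq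
          (by norm_num)) 58 31 (by norm_num)
    · exact not_realizable_of_le h hw (le_of_sq_bound 223 hs (by norm_num)) 62 35 (by norm_num)
  · rcases lt_or_ge n 2 with hw | hw
    · interval_cases n
      · exact not_realizable_of_le h le_rfl (le_of_score_bound 200 hq
          (by norm_num)) 62 31 (by norm_num)
    · exact not_realizable_of_le h hw (le_of_sq_bound 328 hs (by norm_num)) 66 36 (by norm_num)
  · exact not_realizable_of_le h hn (le_of_sq_bound 475 hs (by norm_num)) 66 30 (by norm_num)
  · exact not_realizable_of_le h hn (le_of_sq_bound 686 hs (by norm_num)) 69 32 (by norm_num)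

theorem sq_le_two_pow {k : ℕ} (hk : 20 ≤ k) : (2 * (k + 2) ^ 2 + k + 3) ^ 2 ≤ 2 ^ k := by
  induction k, hk using Nat.le_induction with
  | base => norm_num
  | succ k hk ih =>
    rw [pow_succ 2 k]
    have h1 : (2 * (k + 1 + 2) ^ 2 + (k + 1) + 3) ^ 2 ≤ 2 * (2 * (k + 2) ^ 2 + k + 3) ^ 2 := by
      obtain ⟨d, rfl⟩ := Nat.exists_eq_add_of_le hk
      ring_nf
      gcongr <;> norm_num
    omega

theorem not_realizable_of_twenty_le {k n m : ℕ} (hk : 20 ≤ k) (hn : 1 ≤ n)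
    (h : ∀ f : BinState k → BinState n, Realizable (Fin m) f)
    (hs : (m + 2 * k) ^ 2 < 2 ^ k) : False := by
  -- One output suffices. Passing to `m + 1` units makes the number of units positive, so the
  -- additive term `k + 3` is absorbed into a multiple of `m + 1`.
  have h1 := realizable_mono h hn (Nat.le_succ m)
  have h2 := four_mul_le_of_realizable h1 (4 * (k + 1)) (4 * (k + 3)) (by omega) (by omega)
    (by
      rw [mul_comm 4, pow_mul, ← mul_pow]
      refine Nat.pow_le_pow_left ?_ 4
      rw [mul_comm, add_comm 1 k]
      gcongr
      omega)
    (by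
      rw [mul_comm 4, pow_mul, ← mul_pow]
      refine Nat.pow_le_pow_left ?_ 4
      have : 2 ^ (k + 3) = 2 * 2 ^ (k + 2 * 1) := by ring
      rw [this]
      have : 0 < 2 ^ (k + 2 * 1) := by positivity
      have : 1 ≤ (m + 1) * (1 + k + 1) + 1 := by omega
      nlinarith)
  have h3 : 2 ^ k ≤ (m + 1) * (2 * (k + 2) ^ 2 + k + 3) := by nlinarith
  have h4 : (m + 1) ^ 2 < 2 ^ k := lt_of_le_of_lt (Nat.pow_le_pow_left (by omega) 2) hs
  have h5 : ((m + 1) * (2 * (k + 2) ^ 2 + k + 3)) ^ 2 < (2 ^ k) ^ 2 := by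
    rw [mul_pow, sq (2 ^ k)]
    exact Nat.mul_lt_mul_of_lt_of_le h4 (sq_le_two_pow hk) (by positivity)
  exact absurd h3 (not_le.mpr (lt_of_pow_lt_pow_left₀ 2 (by positivity) h5))

theorem two_pow_le_of_le_eight {k : ℕ} (h1 : 1 ≤ k) (h8 : k ≤ 8) : 2 ^ k ≤ (2 * k) ^ 2 := by
  interval_cases k <;> norm_num

theorem le_of_forall_realizable {k n m : ℕ} (hn : 1 ≤ n) (hkn : 2 ≤ n + k)
    (h : ∀ f : BinState k → BinState n, Realizable (Fin m) f) :
    (2 : ℝ) ^ ((k : ℝ) / 2) - ((n : ℝ) + (k : ℝ)) ^ 2 / (2 * (n : ℝ)) ≤ (m : ℝ) := by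
  by_contra! hlt
  have hn0 : (0 : ℝ) < n := by exact_mod_cast hn
  set R : ℝ := (2 : ℝ) ^ ((k : ℝ) / 2) with hR
  have hR2 : R ^ 2 = 2 ^ k := by
    rw [hR, ← Real.rpow_natCast, ← Real.rpow_mul (by norm_num), ← Real.rpow_natCast]
    congr 1
    push_cast
    ring
  have hbound : 2 * n * m + ((n : ℝ) + k) ^ 2 < 2 * n * R := by
    rw [lt_sub_iff_add_lt, ← lt_sub_iff_add_lt', div_lt_iff₀ (by positivity)] at hlt
    nlinarith
  have hq : (2 * n * m + (n + k) ^ 2) ^ 2 < 4 * n ^ 2 * 2 ^ k := by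
    have := pow_lt_pow_left₀ hbound (by positivity) (two_ne_zero)
    rw [mul_pow, mul_pow, hR2] at this
    norm_num at this
    exact_mod_cast this
  rcases Nat.eq_zero_or_pos k with rfl | hk
  · have h2 : 2 ≤ n := by omega
    refine not_lt_of_score_bound hq ?_
    nlinarith [Nat.mul_le_mul h2 h2, Nat.zero_le (n ^ 2), mul_self_nonneg (n ^ 2 - 4)]
  have hs : (m + 2 * k) ^ 2 < 2 ^ k := by
    -- Since `(n + k) ^ 2 ≥ 4 * n * k`, the subtracted term is at least `2 * k` for every `n`.
    have h1 : (m + 2 * k : ℝ) < R := by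
      have : 2 * (n : ℝ) * (m + 2 * k) < 2 * n * R := by nlinarith [sq_nonneg ((n : ℝ) - k)]
      exact lt_of_mul_lt_mul_left this (by positivity)
    have := pow_lt_pow_left₀ h1 (by positivity) (two_ne_zero)
    rw [hR2] at this
    exact_mod_cast this
  rcases le_or_gt k 8 with h8 | h8
  · exact absurd (hs.trans_le (two_pow_le_of_le_eight hk h8))
      (not_lt.mpr (Nat.pow_le_pow_left (by omega) 2))
  rcases lt_or_ge k 20 with h20 | h20
  · exact not_realizable_of_lt_twenty h8 h20 hn h hq hs
  · exact not_realizable_of_twenty_le h20 hn h hs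

theorem theorem6 (k n m : ℕ) (hn : 1 ≤ n) :
    (min ((2 : ℝ) ^ k - 1) (3 * (n : ℝ) / ((k : ℝ) + 2) * (2 : ℝ) ^ k) ≤ (m : ℝ) →
      ∀ p ∈ deterministicPolicies k n, ApproximatesArbitrarilyWell (CRBM k n m) p) ∧
    (2 ≤ n + k →
      (∀ p ∈ deterministicPolicies k n, ApproximatesArbitrarilyWell (CRBM k n m) p) →
      (2 : ℝ) ^ ((k : ℝ) / 2) - ((n : ℝ) + (k : ℝ)) ^ 2 / (2 * (n : ℝ)) ≤ (m : ℝ)) := by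
  refine ⟨fun hm p hp => ?_, fun hkn h => ?_⟩
  · obtain ⟨f, rfl⟩ := exists_eq_pointMass hp
    exact (realizable_of_le hm f).approximates
  · exact le_of_forall_realizable hn hkn fun f =>
      Realizable.of_approximates (h _ (pointMass_mem f))
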